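/- Let $ZFC^-$ be the theory with the axioms of extensionality, foundation, pairing, union, infinity, the separation scheme, the collection scheme, and the axiom that every set can be well-ordered (there is no power set axiom). Let $\hat V\models ZFC^-$ be $\omega$-nonstandard, i.e. some natural number of $\hat V$ has infinitely many predecessors in $\hat V$. Let $(\hat\omega,\hat<)$ be the linear order of the natural numbers of $\hat V$. For a linear order $(L,<)$ and infinite regular cardinals $\kappa,\theta$, a $(\kappa,\theta)$-cut in $L$ is a pair of sequences $(a_\alpha)_{\alpha<\kappa}$, $(b_\beta)_{\beta<\theta}$ from $L$ such that $a_\alpha<a_{\alpha'}<b_{\beta'}<b_\beta$ whenever $\alpha<\alpha'<\kappa$ and $\beta<\beta'<\theta$, and such that there is no $c\in L$ with $a_\alpha<c<b_\beta$ for all $\alpha<\kappa$, $\beta<\theta$. Let $\mathcal C_{\hat V}$ be the set of pairs $(\kappa,\theta)$ of infinite regular cardinals such that $(\hat\omega,\hat<)$ admits a $(\kappa,\theta)$-cut, and let $\mathfrak p_{\hat V}=\min\{\kappa+\theta:(\kappa,\theta)\in\mathcal C_{\hat V}\}$. Let $\mathfrak t_{\hat V}$ be the least infinite regular cardinal $\kappa$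 such that for some $\hat n\in\hat\omega$ there is a strictly increasing sequence $(s_\alpha)_{\alpha<\kappa}$ with no upper bound in the tree $(\hat n^{<\hat n},\subseteq)$, where $\hat n^{<\hat n}$ is the set of all elements of $\hat V$ that are, in the sense of $\hat V$, functions from some $\hat m<\hat n$ to $\hat n$. (A minimum over the empty set is read as $\infty$.) **Theorem.** Let $\kappa$ be an infinite regular cardinal with $\kappa<\min(\mathfrak p_{\hat V}^+,\mathfrak t_{\hat V})$. Then there is a unique regular cardinal $\lambda$ with $(\kappa,\lambda)\in\mathcal C_{\hat V}$; moreover, this same $\lambda$ is also the unique regular cardinal with $(\lambda,\kappa)\in\mathcal C_{\hat V}$. -/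

import Mathlib

universe u

noncomputable section

/-! ### Cut spectra and tree-tops -/

/-- `(a, b)` is a pre-cut in `L`: `a α < a α' < b β' < b β` for all `α < α' < κ`, `β < β' < θ`. -/
def IsPreCut {L : Type u} [LT L] {κ θ : Cardinal.{u}}
    (a : Set.Iio κ.ord → L) (b : Set.Iio θ.ord → L) : Prop :=
  ∀ α α' β β', α < α' → β < β' → a α < a α' ∧ a α' < b β' ∧ b β' < b β

/-- `(a, b)` is a cut in `L`: a pre-cut which no element of `L` fills. -/
def IsCut {L : Type u} [LT L] {κ θ : Cardinal.{u}}
    (a : Set.Iio κ.ord → L) (b : Set.Iio θ.ord → L) : Prop :=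
  IsPreCut a b ∧ ¬ ∃ c : L, ∀ α β, a α < c ∧ c < b β

/-- The cut spectrum of a linear order `L`: the pairs `(κ, θ)` of infinite regular cardinals such
that `L` admits a `(κ, θ)`-cut. -/
def cutSpectrum (L : Type u) [LT L] : Set (Cardinal.{u} × Cardinal.{u}) :=
  {p | p.1.IsRegular ∧ p.2.IsRegular ∧
    ∃ (a : Set.Iio p.1.ord → L) (b : Set.Iio p.2.ord → L), IsCut a b}

/-- The least `κ + θ` with `(κ, θ)` in the cut spectrum (`⊤` if the spectrum is empty). -/
def cutNumber (L : Type u) [LT L] : WithTop Cardinal.{u} :=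
  ⨅ p ∈ cutSpectrum L, ((p.1 + p.2 : Cardinal.{u}) : WithTop Cardinal.{u})

/-- For a tree `T`, the least infinite regular `κ` such that there is an increasing sequence of
length `κ` from `T` with no upper bound in `T` (`⊤` if there is none). -/
def treeTops (T : Type u) [Preorder T] : WithTop Cardinal.{u} :=
  ⨅ κ ∈ {κ : Cardinal.{u} | κ.IsRegular ∧
    ∃ s : Set.Iio κ.ord → T, StrictMono s ∧ ¬ ∃ t : T, ∀ α, s α ≤ t},
    (κ : WithTop Cardinal.{u})

/-! ### Models of set theory without power set -/

/-- The relation symbols of the language of set theory: one binary symbol. -/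
inductive SetLangRel : ℕ → Type
  | mem : SetLangRel 2

/-- The first-order language of set theory. -/
def setLang : FirstOrder.Language.{0, 0} := ⟨fun _ => Empty, SetLangRel⟩

namespace SetModel

variable {M : Type u} [setLang.Structure M]

/-- `x` is an element of `y` in the sense of the model. -/
def Mem (x y : M) : Prop :=
  FirstOrder.Language.Structure.RelMap (L := setLang) (n := 2) SetLangRel.mem ![x, y]

/-- `a` is the empty set of the model. -/
def IsEmptySet (a : M) : Prop := ∀ x, ¬ Mem x a

/-- `a ⊆ b` in the model. -/
def Sub (a b : M) : Prop := ∀ x, Mem x a → Mem x b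

/-- `a = {x, y}` in the model. -/
def IsUnorderedPair (a x y : M) : Prop := ∀ z, Mem z a ↔ z = x ∨ z = y

/-- `p` is the ordered pair `(x, y) = {{x}, {x, y}}` of the model. -/
def IsOrderedPair (p x y : M) : Prop :=
  ∃ u v, IsUnorderedPair u x x ∧ IsUnorderedPair v x y ∧ IsUnorderedPair p u v

/-- `(x, y) ∈ r` in the model. -/
def PairMem (r x y : M) : Prop := ∃ p, IsOrderedPair p x y ∧ Mem p r

/-- `s = x ∪ {x}` in the model. -/
def IsSuccessor (s x : M) : Prop := ∀ z, Mem z s ↔ Mem z x ∨ z = x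

/-- `w` contains the empty set and is closed under `x ↦ x ∪ {x}`, in the model. -/
def IsInductiveSet (w : M) : Prop :=
  (∃ e, IsEmptySet e ∧ Mem e w) ∧ ∀ x, Mem x w → ∃ s, IsSuccessor s x ∧ Mem s w

/-- `r` is (in the model) a strict well-ordering of the set `a`. -/
def WellOrders (r a : M) : Prop :=
  (∀ x, Mem x a → ¬ PairMem r x x) ∧
  (∀ x y z, Mem x a → Mem y a → Mem z a → PairMem r x y → PairMem r y z → PairMem r x z) ∧
  (∀ x y, Mem x a → Mem y a → PairMem r x y ∨ x = y ∨ PairMem r y x) ∧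
  ∀ b, Sub b a → (∃ x, Mem x b) → ∃ m, Mem m b ∧ ∀ y, Mem y b → y ≠ m → PairMem r m y

/-- `f` is (in the model) a function with domain `a` and all values in `b`. -/
def IsFunction (f a b : M) : Prop :=
  (∀ p, Mem p f → ∃ x y, Mem x a ∧ Mem y b ∧ IsOrderedPair p x y) ∧
  ∀ x, Mem x a → ∃! y, PairMem f x y

variable (M) in
/-- `M` is a model of `ZFC⁻`: set theory without power set, with the collection scheme and with the
principle that every set can be well-ordered. In the two schemes the formulas range over all
first-order formulas of the language of set theory with parameters from `M`. -/
structure IsZFCMinus : Prop where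
  extensionality : ∀ a b : M, (∀ x, Mem x a ↔ Mem x b) → a = b
  foundation : ∀ a : M, (∃ x, Mem x a) → ∃ x, Mem x a ∧ ∀ y, Mem y a → ¬ Mem y x
  pairing : ∀ x y : M, ∃ a, IsUnorderedPair a x y
  union : ∀ a : M, ∃ b, ∀ x, Mem x b ↔ ∃ y, Mem y a ∧ Mem x y
  infinity : ∃ w : M, IsInductiveSet w
  separation : ∀ P : Set M, (Set.univ : Set M).Definable₁ setLang P →
    ∀ a : M, ∃ b, ∀ x, Mem x b ↔ Mem x a ∧ x ∈ P
  collection : ∀ R : Set (M × M), (Set.univ : Set M).Definable₂ setLang R →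
    ∀ a : M, (∀ x, Mem x a → ∃ y, (x, y) ∈ R) →
      ∃ b, ∀ x, Mem x a → ∃ y, Mem y b ∧ (x, y) ∈ R
  wellOrdering : ∀ a : M, ∃ r, WellOrders r a

variable (M) in
/-- The natural numbers of the model, i.e. the elements of its least inductive set. -/
def Omega : Type u := {n : M // ∀ w : M, IsInductiveSet w → Mem n w}

/-- The order of the natural numbers of the model is its membership relation. -/
instance : LT (Omega M) := ⟨fun m n => Mem m.1 n.1⟩

variable (M) in
/-- Some natural number of the model has infinitely many predecessors. -/
def IsOmegaNonstandard : Prop := ∃ n : Omega M, {m : Omega M | m < n}.Infinite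

/-- The tree `n^{<n}` of the model: all its functions from some `m < n` to `n`. -/
def FinSeq (n : Omega M) : Type u := {s : M // ∃ m : Omega M, m < n ∧ IsFunction s m.1 n.1}

/-- `n^{<n}` is ordered by inclusion. -/
instance (n : Omega M) : Preorder (FinSeq n) where
  le s t := Sub s.1 t.1
  le_refl _ _ hx := hx
  le_trans _ _ _ hst htu x hx := htu x (hst x hx)

variable (M) in
/-- The cut spectrum of the natural numbers of the model. -/
def spectrum : Set (Cardinal.{u} × Cardinal.{u}) := cutSpectrum (Omega M)

variable (M) in
/-- The invariant `𝔭` of the model. -/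
def pInv : WithTop Cardinal.{u} := cutNumber (Omega M)

variable (M) in
/-- The invariant `𝔱` of the model. -/
def tInv : WithTop Cardinal.{u} := ⨅ n : Omega M, treeTops (FinSeq n)

end SetModel

end

/-!
The natural numbers of the model form a discrete linear order `ω` in which every nonempty definable
set has a least element and every nonempty bounded one a greatest. Cuts of `ω` read from above are cuts of
the reverse order `ωᵒᵈ`, so the theorem says that a `κ`-sequence which increases in `ω` and one which
increases in `ω` or in `ωᵒᵈ`, if they are lower halves of cuts, have upper halves of the same regular
length, and that such halves exist in `ω` and in `ωᵒᵈ`.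

Existence uses `κ ≤ 𝔭` (`exists_cut_of_le_cutNumber`). In an infinite interval `(c, d)`, let `T` be
the set of points that are infinitely far below `d`. If `T` had a cofinality smaller than `κ`, a
cofinal sequence of `T` together with the iterated predecessors of `d` would be a cut of size less
than `κ`. Hence `T` contains an increasing `κ`-sequence, and discreteness shows that its strict upper
bounds have no least element, so their coinitiality is an infinite regular cardinal.

Uniqueness uses `κ < 𝔱` (`SetModel.right_cofinality_unique`). Given lower halves `a` in `ω` and `a'`
in `ω` or `ωᵒᵈ`, finite sequences of the model with last argument `a α` and last value `a' α`, and with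
all values at most `a' α`, are built by recursion on `α < κ`, each extending the earlier ones: at stage
`α` an upper bound of the earlier ones exists, and replacing its values above `a' α` by `a' α` leaves
the earlier ones intact. An upper bound `t` of all of them is one set of the model with
`t (a α) = a' α`. The relation "all values of `t` up to `e` are at most `y`" is definable, so
overspill shows that every `y` above `a'` is related to some `e` above `a`, while no `e` above `a` is
related to all `y` above `a'`. Such a relation forces both coinitialities to agree
(`coinitiality_eq_of_relation`).
-/

noncomputable section

/-! ### Transfinite sequences and cofinality -/

section Order

open Set Cardinal

/-- Transfinite recursion for sequences: if every stage can be chosen so as to satisfy `P` and to be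
`R`-related to all earlier stages, then there is a sequence all of whose stages are so chosen. -/
theorem exists_seq_of_step {I T : Type*} [LinearOrder I] [WellFoundedLT I] [Nonempty T]
    (P : I → T → Prop) (R : T → T → Prop)
    (step : ∀ (i : I) (f : I → T), (∀ j < i, P j (f j)) →
      (∀ j k, j < k → k < i → R (f j) (f k)) → ∃ t, P i t ∧ ∀ j < i, R (f j) t) :
    ∃ f : I → T, (∀ i, P i (f i)) ∧ ∀ i j, i < j → R (f i) (f j) := by
  classical
  let F : ∀ i : I, (∀ j : I, j < i → T) → T := fun i g =>
    if h : ∃ t, P i t ∧ ∀ j (hj : j < i), R (g j hj) t then h.choose else Classical.arbitrary T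
  let f : I → T := (wellFounded_lt (α := I)).fix F
  have hf : ∀ i, f i = F i (fun j _ => f j) := fun i => WellFounded.fix_eq _ F i
  have key : ∀ i, P i (f i) ∧ ∀ j < i, R (f j) (f i) := by
    intro i
    induction i using (wellFounded_lt (α := I)).induction with
    | _ i ih =>
      have h : ∃ t, P i t ∧ ∀ j (_ : j < i), R (f j) t :=
        step i f (fun j hj => (ih j hj).1) fun j k hjk hk => (ih k hk).2 j hjk
      have : f i = h.choose := by
        rw [hf]
        simp only [F]
        rw [dif_pos h]
      rw [this]
      exact h.choose_spec
  exact ⟨f, fun i => (key i).1, fun i j hij => (key j).2 i hij⟩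

/-- In an order of cofinality at least `κ`, any `κ`-sequence is dominated by an increasing one. -/
theorem exists_strictMono_ge {T : Type u} [LinearOrder T] [Nonempty T] {κ : Cardinal.{u}}
    (hκ : κ ≤ Order.cof T) (hinf : ℵ₀ ≤ κ) (g : Iio κ.ord → T) :
    ∃ f : Iio κ.ord → T, StrictMono f ∧ ∀ α, g α ≤ f α := by
  obtain ⟨f, hf, hR⟩ := exists_seq_of_step (I := Iio κ.ord) (T := T)
    (fun α t => g α ≤ t) (· < ·) (by
      intro α f _ _
      -- fewer than `κ` values cannot be cofinal
      have hnc : ¬ IsCofinal ((fun x : Iio α => f x.1) '' univ ∪ {g α}) := by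
        intro hc
        have h1 : #↥((fun x : Iio α => f x.1) '' univ ∪ {g α} : Set T) < κ := by
          refine (mk_union_le _ _).trans_lt ?_
          refine add_lt_of_lt hinf ?_ (by simpa using one_lt_aleph0.trans_le hinf)
          rw [image_univ, ← lift_lt.{u, u + 1}]
          refine (mk_range_le_lift (f := fun x : Iio α => f x.1)).trans_lt ?_
          have h2 : #(Iio α) ≤ lift.{u + 1} α.1.card := by
            rw [← Cardinal.mk_Iio_ordinal]
            exact mk_le_of_injective (f := fun x : Iio α => (⟨x.1.1, x.2⟩ : Iio α.1))
              fun x y h => by simpa [Subtype.ext_iff] using h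
          refine (lift_le.2 h2).trans_lt ?_
          have h3 : lift.{u + 1} α.1.card < lift.{u + 1} κ := lift_lt.2 (lt_ord.1 α.2)
          rwa [lift_lift]
        exact absurd (hκ.trans (Order.cof_le hc)) (not_le.2 h1)
      obtain ⟨t, ht⟩ := not_isCofinal_iff.1 hnc
      exact ⟨t, (ht _ (Or.inr rfl)).le, fun j hj => ht _ (Or.inl ⟨⟨j, hj⟩, trivial, rfl⟩)⟩)
  exact ⟨f, fun i j h => hR i j h, hf⟩

/-- A linear order without a largest element has an increasing cofinal sequence of regular length,
namely of the length of its cofinality. -/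
theorem exists_strictMono_cofinal (T : Type u) [LinearOrder T] [NoMaxOrder T] [Nonempty T] :
    (Order.cof T).IsRegular ∧
      ∃ f : Iio (Order.cof T).ord → T, StrictMono f ∧ ∀ t, ∃ α, t ≤ f α := by
  have hinf : ℵ₀ ≤ Order.cof T := Order.aleph0_le_cof
  obtain ⟨s, hs, hcard⟩ := Order.exists_cof_eq T
  have he : Nonempty (Iio (Order.cof T).ord ≃ s) := by
    rw [← lift_mk_eq'.{u + 1, u}, hcard, mk_Iio_ordinal]
    simp
  obtain ⟨e⟩ := he
  obtain ⟨f, hf, hge⟩ := exists_strictMono_ge le_rfl hinf fun α => (e α : T)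
  have hcof : ∀ t, ∃ α, t ≤ f α := by
    intro t
    obtain ⟨y, hy, hty⟩ := hs t
    exact ⟨e.symm ⟨y, hy⟩, hty.trans (by simpa using hge (e.symm ⟨y, hy⟩))⟩
  refine ⟨⟨hinf, ?_⟩, f, hf, hcof⟩
  -- a cofinal subset of the index set is carried to a cofinal subset of `T`
  have h1 : lift.{u} (Order.cof (Iio (Order.cof T).ord)) = lift.{u + 1} (Order.cof T) :=
    Order.lift_cof_congr_of_strictMono hf (by
      intro t
      obtain ⟨α, h⟩ := hcof t
      exact ⟨_, ⟨α, rfl⟩, h⟩)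
  rw [Ordinal.cof_Iio, ← Ordinal.lift_cof] at h1
  have h2 : lift.{u+1} (Order.cof T).ord.cof = lift.{u+1} (Order.cof T) := by
    simpa using h1
  exact (lift_inj.1 h2).ge

/-- A map between initial ordinals with unbounded range bounds the regular target. -/
theorem Cardinal.IsRegular.le_of_cofinal_map {μ ν : Cardinal.{u}} (hμ : μ.IsRegular)
    (h : Iio ν.ord → Iio μ.ord) (hc : ∀ γ, ∃ β, γ ≤ h β) : μ ≤ ν := by
  have h1 : Order.cof (Iio μ.ord) ≤ #(range h) := Order.cof_le fun γ => by
    obtain ⟨β, hβ⟩ := hc γ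
    exact ⟨_, ⟨β, rfl⟩, hβ⟩
  rw [Ordinal.cof_Iio, ← Ordinal.lift_cof, hμ.cof_ord] at h1
  have h2 := h1.trans (mk_range_le (f := h))
  rw [mk_Iio_ordinal] at h2
  simpa using h2

theorem Cardinal.IsRegular.exists_gt {κ : Cardinal.{u}} (hκ : κ.IsRegular) (α : Iio κ.ord) :
    ∃ β, α < β :=
  ⟨⟨α.1 + 1, (isSuccLimit_ord hκ.aleph0_le).add_one_lt α.2⟩, by
    rw [← Subtype.coe_lt_coe]; exact lt_add_one _⟩

theorem Cardinal.IsRegular.nonempty_Iio {κ : Cardinal.{u}} (hκ : κ.IsRegular) :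
    Nonempty (Iio κ.ord) := ⟨⟨0, hκ.ord_pos⟩⟩

/-! ### Cuts in linear orders -/

/-- For regular lengths, the lower half of a cut is increasing, and the upper half is decreasing and
coinitial in the strict upper bounds of the lower one. -/
theorem isCut_iff {L : Type u} [LinearOrder L] {κ θ : Cardinal.{u}} (hκ : κ.IsRegular)
    (hθ : θ.IsRegular) {a : Iio κ.ord → L} {b : Iio θ.ord → L} :
    IsCut a b ↔ StrictMono a ∧ StrictAnti b ∧ (∀ α β, a α < b β) ∧
      ∀ x, (∀ α, a α < x) → ∃ β, b β ≤ x := by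
  obtain ⟨α₀⟩ := hκ.nonempty_Iio
  obtain ⟨β₀⟩ := hθ.nonempty_Iio
  obtain ⟨α₁, h₁⟩ := hκ.exists_gt α₀
  obtain ⟨β₁, h₂⟩ := hθ.exists_gt β₀
  constructor
  · rintro ⟨hp, hf⟩
    have ha : StrictMono a := fun α α' h => (hp α α' β₀ β₁ h h₂).1
    refine ⟨ha, fun β β' h => (hp α₀ α₁ β β' h₁ h).2.2, ?_, ?_⟩
    · intro α β
      obtain ⟨α', h⟩ := hκ.exists_gt α
      obtain ⟨β', h'⟩ := hθ.exists_gt β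
      have := hp α α' β β' h h'
      exact this.1.trans (this.2.1.trans this.2.2)
    · intro x hx
      by_contra! hc
      exact hf ⟨x, fun α β => ⟨hx α, hc β⟩⟩
  · rintro ⟨ha, hb, hab, hco⟩
    refine ⟨fun α α' β β' h h' => ⟨ha h, hab _ _, hb h'⟩, ?_⟩
    rintro ⟨c, hc⟩
    obtain ⟨β, hβ⟩ := hco c fun α => (hc α β₀).1
    exact absurd (hc α₀ β).2 (not_lt.2 hβ)

theorem mem_cutSpectrum_orderDual {L : Type u} [LinearOrder L] {κ θ : Cardinal.{u}} :
    (κ, θ) ∈ cutSpectrum Lᵒᵈ ↔ (θ, κ) ∈ cutSpectrum L := by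
  have aux : ∀ {L : Type u} [LinearOrder L] {κ θ : Cardinal.{u}},
      (κ, θ) ∈ cutSpectrum Lᵒᵈ → (θ, κ) ∈ cutSpectrum L := by
    rintro L _ κ θ ⟨hκ, hθ, a, b, hp, hc⟩
    refine ⟨hθ, hκ, fun i => OrderDual.ofDual (b i), fun i => OrderDual.ofDual (a i), ?_, ?_⟩
    · intro β β' α α' h h'
      have := hp α α' β β' h' h
      exact ⟨this.2.2, this.2.1, this.1⟩
    · rintro ⟨c, h⟩
      exact hc ⟨OrderDual.toDual c, fun α β => ⟨(h β α).2, (h β α).1⟩⟩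
  exact ⟨aux, fun h => aux (L := Lᵒᵈ) h⟩

/-- A relation `E` between the upper halves `U₁`, `U₂` of two cuts which is antitone in its first
and monotone in its second argument, and neither holds nor fails on a whole section, forces the
two coinitialities to agree. -/
theorem coinitiality_eq_of_relation {L₁ L₂ : Type u} [LinearOrder L₁] [LinearOrder L₂]
    {μ ν : Cardinal.{u}} (hμ : μ.IsRegular) (hν : ν.IsRegular) {U₁ : Set L₁} {U₂ : Set L₂}
    {b₁ : Iio μ.ord → L₁} {b₂ : Iio ν.ord → L₂} (hb₁ : StrictAnti b₁) (hb₂ : StrictAnti b₂)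
    (hU₁ : ∀ β, b₁ β ∈ U₁) (hU₂ : ∀ β, b₂ β ∈ U₂)
    (hc₁ : ∀ x ∈ U₁, ∃ β, b₁ β ≤ x) (hc₂ : ∀ x ∈ U₂, ∃ β, b₂ β ≤ x)
    (E : L₁ → L₂ → Prop) (hE₁ : ∀ x x' y, x' ≤ x → E x y → E x' y)
    (hE₂ : ∀ x y y', y ≤ y' → E x y → E x y')
    (hpos : ∀ y ∈ U₂, ∃ x ∈ U₁, E x y) (hneg : ∀ x ∈ U₁, ∃ y ∈ U₂, ¬ E x y) : μ = ν := by
  have hpos' : ∀ β, ∃ γ, E (b₁ γ) (b₂ β) := by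
    intro β
    obtain ⟨x, hx, h⟩ := hpos _ (hU₂ β)
    obtain ⟨γ, hγ⟩ := hc₁ x hx
    exact ⟨γ, hE₁ _ _ _ hγ h⟩
  have hneg' : ∀ γ, ∃ β, ¬ E (b₁ γ) (b₂ β) := by
    intro γ
    obtain ⟨y, hy, h⟩ := hneg _ (hU₁ γ)
    obtain ⟨β, hβ⟩ := hc₂ y hy
    exact ⟨β, fun h' => h (hE₂ _ _ _ hβ h')⟩
  choose p hp using hpos'
  choose q hq using hneg'
  refine le_antisymm (hμ.le_of_cofinal_map p fun γ => ⟨q γ, ?_⟩)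
    (hν.le_of_cofinal_map q fun β => ⟨p β, ?_⟩)
  · by_contra! h
    exact hq γ (hE₁ _ _ _ (hb₁ h).le (hp (q γ)))
  · by_contra! h
    exact hq (p β) (hE₂ _ _ _ (hb₂ h).le (hp β))

/-- A discrete linear order has no `κ`-sequence with a least strict upper bound, so every bounded
increasing `κ`-sequence is the lower half of a cut. -/
theorem exists_cut_of_strictMono {L : Type u} [LinearOrder L]
    (hpred : ∀ x y : L, x < y → ∃ z, z ⋖ y) {κ : Cardinal.{u}} (hκ : κ.IsRegular)
    (a : Iio κ.ord → L) (ha : StrictMono a) (d : L) (hd : ∀ α, a α < d) :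
    ∃ θ, (κ, θ) ∈ cutSpectrum L := by
  obtain ⟨α₀⟩ := hκ.nonempty_Iio
  let U : Type u := {x : L // ∀ α, a α < x}
  have hmin : ∀ u : U, ∃ v : U, v < u := by
    rintro ⟨u, hu⟩
    obtain ⟨z, hz⟩ := hpred _ _ (hu α₀)
    refine ⟨⟨z, fun α => ?_⟩, hz.lt⟩
    obtain ⟨α', h⟩ := hκ.exists_gt α
    exact (ha h).trans_le (hz.le_of_lt (hu α'))
  have : NoMaxOrder Uᵒᵈ := ⟨fun u => hmin (OrderDual.ofDual u)⟩
  have : Nonempty Uᵒᵈ := ⟨OrderDual.toDual ⟨d, hd⟩⟩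
  obtain ⟨hreg, f, hf, hcof⟩ := exists_strictMono_cofinal Uᵒᵈ
  refine ⟨_, hκ, hreg, a, fun β => (OrderDual.ofDual (f β)).1,
    (isCut_iff hκ hreg).2 ⟨ha, fun β β' h => hf h, fun α β => (OrderDual.ofDual (f β)).2 α, ?_⟩⟩
  intro x hx
  obtain ⟨β, hβ⟩ := hcof (OrderDual.toDual ⟨x, hx⟩)
  exact ⟨β, hβ⟩

/-- In a discrete linear order with an infinite interval, every regular `κ` which is at most the
size of every cut is the left cofinality of some cut. -/
theorem exists_cut_of_le_cutNumber {L : Type u} [LinearOrder L]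
    (hpred : ∀ x y : L, x < y → ∃ z, z ⋖ y) (hsucc : ∀ x y : L, x < y → ∃ z, x ⋖ z)
    (c d : L) (hinf : (Ioo c d).Infinite) {κ : Cardinal.{u}} (hκ : κ.IsRegular)
    (hle : ∀ μ ν, (μ, ν) ∈ cutSpectrum L → κ ≤ μ + ν) :
    ∃ θ, (κ, θ) ∈ cutSpectrum L := by
  classical
  let T : Type u := {x : L // (Ioo x d).Infinite}
  have : Nonempty T := ⟨⟨c, hinf⟩⟩
  have hTd : ∀ x : T, x.1 < d := fun x => by
    obtain ⟨y, hy⟩ := x.2.nonempty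
    exact hy.1.trans hy.2
  have : NoMaxOrder T := ⟨by
    rintro ⟨x, hx⟩
    obtain ⟨y, hy⟩ := hx.nonempty
    obtain ⟨z, hz⟩ := hsucc x y hy.1
    refine ⟨⟨z, (hx.sdiff (finite_singleton z)).mono ?_⟩, hz.lt⟩
    rintro w ⟨⟨h1, h2⟩, h3⟩
    exact ⟨lt_of_le_of_ne (hz.ge_of_gt h1) (Ne.symm h3), h2⟩⟩
  by_cases hcof : κ ≤ Order.cof T
  · obtain ⟨f, hf, -⟩ := exists_strictMono_ge hcof hκ.aleph0_le fun _ => Classical.arbitrary T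
    exact exists_cut_of_strictMono hpred hκ (fun α => (f α).1) (fun α β h => hf h) d
      fun α => hTd _
  exfalso
  push Not at hcof
  obtain ⟨hreg, f, hf, hfc⟩ := exists_strictMono_cofinal T
  -- `D` consists of `d`, its predecessor, the predecessor of that, and so on
  let D : Type u := {x : L // x ≤ d ∧ (Ico x d).Finite ∧ c ≤ x}
  have hcd : c < d := hTd ⟨c, hinf⟩
  have : Nonempty Dᵒᵈ := ⟨OrderDual.toDual ⟨d, le_rfl, by simp, hcd.le⟩⟩
  have : NoMaxOrder Dᵒᵈ := ⟨by
    refine OrderDual.rec ?_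
    rintro ⟨x, hxd, hfin, hcx⟩
    have hcx' : c < x := lt_of_le_of_ne hcx fun h => hinf (h ▸ hfin.subset Ioo_subset_Ico_self)
    obtain ⟨z, hz⟩ := hpred c x hcx'
    refine ⟨OrderDual.toDual ⟨z, hz.le.trans hxd, (hfin.union (finite_singleton z)).subset ?_,
      hz.le_of_lt hcx'⟩, hz.lt⟩
    rintro w ⟨h1, h2⟩
    rcases eq_or_lt_of_le h1 with h | h
    · exact Or.inr h.symm
    · exact Or.inl ⟨hz.ge_of_gt h, h2⟩⟩
  have hDcount : Countable Dᵒᵈ := by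
    refine Function.Injective.countable
      (f := fun x : Dᵒᵈ => (Ico (OrderDual.ofDual x).1 d).ncard) ?_
    have key : ∀ x y : D, x.1 < y.1 → (Ico y.1 d).ncard < (Ico x.1 d).ncard := by
      rintro ⟨x, hx⟩ ⟨y, hy⟩ h
      refine ncard_lt_ncard ⟨Ico_subset_Ico_left h.le, fun hs => ?_⟩ hx.2.1
      exact absurd (hs ⟨le_rfl, h.trans_le hy.1⟩).1 (not_le.2 h)
    intro x y hxy
    rcases lt_trichotomy (OrderDual.ofDual x).1 (OrderDual.ofDual y).1 with h | h | h
    · exact absurd hxy (key _ _ h).ne'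
    · exact Subtype.ext h
    · exact absurd hxy (key _ _ h).ne
  obtain ⟨hregD, g, hg, hgc⟩ := exists_strictMono_cofinal Dᵒᵈ
  have hDcof : Order.cof Dᵒᵈ = ℵ₀ := Order.cof_eq_aleph0
  refine absurd (hle (Order.cof T) (Order.cof Dᵒᵈ) ⟨hreg, hregD, fun α => (f α).1,
    fun β => (OrderDual.ofDual (g β)).1, (isCut_iff hreg hregD).2
      ⟨fun _ _ h => hf h, fun _ _ h => hg h, ?_, ?_⟩⟩) (not_le.2 ?_)
  · intro α β
    by_contra! h
    exact (f α).2 ((OrderDual.ofDual (g β)).2.2.1.subset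
      ((Ioo_subset_Ioo_left h).trans Ioo_subset_Ico_self))
  · intro x hx
    by_cases hxd : x ≤ d
    · have hfin : (Ico x d).Finite := by
        by_contra h
        have h' : (Ioo x d).Infinite := fun hf' => h
          ((hf'.union (finite_singleton x)).subset fun w hw =>
            (eq_or_lt_of_le hw.1).elim (fun e => Or.inr e.symm) fun e => Or.inl ⟨e, hw.2⟩)
        obtain ⟨α, hα⟩ := hfc ⟨x, h'⟩
        exact absurd (hx α) (not_lt.2 hα)
      obtain ⟨α, hα⟩ := hfc ⟨c, hinf⟩
      obtain ⟨β, hβ⟩ := hgc (OrderDual.toDual ⟨x, hxd, hfin, le_trans hα (hx α).le⟩)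
      exact ⟨β, hβ⟩
    · obtain ⟨β⟩ := hregD.nonempty_Iio
      exact ⟨β, (OrderDual.ofDual (g β)).2.1.trans (not_le.1 hxd).le⟩
  · rw [hDcof]
    exact add_lt_of_lt hκ.aleph0_le hcof (hDcof ▸ by
      exact (hDcof.le.trans hreg.aleph0_le).trans_lt hcof)

/-- If increasing sequences of every regular length at most `κ` are bounded in `T`, then so is
every increasing family indexed by a linear order of size at most `κ`. -/
theorem exists_upper_bound_of_strictMono {T : Type u} [Preorder T] [Nonempty T]
    {κ : Cardinal.{u}}
    (hT : ∀ μ : Cardinal.{u}, μ.IsRegular → μ ≤ κ → ∀ s : Iio μ.ord → T, StrictMono s →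
      ∃ t, ∀ α, s α ≤ t)
    {I : Type u} [LinearOrder I] (hI : #I ≤ κ) (f : I → T) (hf : StrictMono f) :
    ∃ t, ∀ i, f i ≤ t := by
  rcases isEmpty_or_nonempty I with hI' | hI'
  · exact ⟨Classical.arbitrary T, fun i => isEmptyElim i⟩
  by_cases hmax : ∃ m : I, ∀ i, i ≤ m
  · obtain ⟨m, hm⟩ := hmax
    exact ⟨f m, fun i => hf.monotone (hm i)⟩
  push Not at hmax
  have : NoMaxOrder I := ⟨hmax⟩
  obtain ⟨hreg, g, hg, hgc⟩ := exists_strictMono_cofinal I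
  obtain ⟨t, ht⟩ := hT _ hreg ((Order.cof_le_cardinalMk I).trans hI) (f ∘ g) (hf.comp hg)
  refine ⟨t, fun i => ?_⟩
  obtain ⟨α, hα⟩ := hgc i
  exact (hf.monotone hα).trans (ht α)

/-- The same for the initial segments of a sequence indexed by the ordinals below `κ`. -/
theorem exists_upper_bound_of_initial_segment {T : Type u} [Preorder T] [Nonempty T]
    {κ : Cardinal.{u}}
    (hT : ∀ μ : Cardinal.{u}, μ.IsRegular → μ ≤ κ → ∀ s : Iio μ.ord → T, StrictMono s →
      ∃ t, ∀ α, s α ≤ t)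
    (α : Iio κ.ord) (f : Iio κ.ord → T) (hf : ∀ j k, j < k → k < α → f j < f k) :
    ∃ t, ∀ j < α, f j ≤ t := by
  let e := Ordinal.ToType.mk (o := α.1)
  let i : α.1.ToType → Iio κ.ord := fun x =>
    ⟨(e.symm x).1, lt_trans (mem_Iio.1 (e.symm x).2) (mem_Iio.1 α.2)⟩
  obtain ⟨t, ht⟩ := exists_upper_bound_of_strictMono hT (I := α.1.ToType)
    (by simpa using (lt_ord.1 α.2).le) (fun x => f (i x)) (fun x y h =>
      hf _ _ (e.symm.strictMono h) (e.symm y).2)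
  refine ⟨t, fun j hj => ?_⟩
  have := ht (e ⟨j.1, hj⟩)
  simpa [i] using this

end Order

namespace SetModel

open FirstOrder FirstOrder.Language Set

/-! ### Definable predicates -/

section Definability

variable {M : Type u} {α : Type}

/-- A function of tuples is a variable or a parameter. -/
def IsTerm (t : (α → M) → M) : Prop := (∃ i, t = fun v => v i) ∨ ∃ c, t = fun _ => c

theorem IsTerm.var (i : α) : IsTerm fun v : α → M => v i := Or.inl ⟨i, rfl⟩

theorem IsTerm.const (c : M) : IsTerm fun _ : α → M => c := Or.inr ⟨c, rfl⟩

theorem IsTerm.weaken {t : (α → M) → M} (h : IsTerm t) :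
    IsTerm fun w : α ⊕ Fin 1 → M => t fun a => w (Sum.inl a) := by
  rcases h with ⟨i, rfl⟩ | ⟨c, rfl⟩
  · exact .var _
  · exact .const _

variable [setLang.Structure M]

/-- A predicate of tuples is definable with parameters. In the closure lemmas `Dfn.ex` and `Dfn.all`
below, the tuple under the quantifier is indexed by `α ⊕ Fin 1`, where `Sum.inr 0` is the bound
variable. -/
def Dfn (P : (α → M) → Prop) : Prop := (univ : Set M).Definable setLang {v | P v}

theorem IsTerm.exists_term {t : (α → M) → M} (h : IsTerm t) :
    ∃ s : setLang[[(univ : Set M)]].Term α, ∀ v, s.realize v = t v := by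
  rcases h with ⟨i, rfl⟩ | ⟨c, rfl⟩
  · exact ⟨Term.var i, fun v => rfl⟩
  · exact ⟨(setLang.con (⟨c, trivial⟩ : (univ : Set M))).term, fun v => by simp⟩

theorem Dfn.eq {s t : (α → M) → M} (hs : IsTerm s) (ht : IsTerm t) :
    Dfn fun v => s v = t v := by
  obtain ⟨s', hs⟩ := hs.exists_term
  obtain ⟨t', ht⟩ := ht.exists_term
  exact ⟨s'.equal t', by ext v; simp [hs, ht]⟩

theorem Dfn.mem {s t : (α → M) → M} (hs : IsTerm s) (ht : IsTerm t) :
    Dfn fun v => Mem (s v) (t v) := by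
  obtain ⟨s', hs⟩ := hs.exists_term
  obtain ⟨t', ht⟩ := ht.exists_term
  refine ⟨((setLang.lhomWithConstants (univ : Set M)).onRelation
    (SetLangRel.mem : setLang.Relations 2)).formula₂ s' t', ?_⟩
  ext v
  simp only [mem_ofPred_eq, Formula.realize_rel₂, hs, ht]
  exact (iff_of_eq (LHom.map_onRelation (setLang.lhomWithConstants (univ : Set M)) _ _)).symm

theorem Dfn.and {P Q : (α → M) → Prop} (hP : Dfn P) (hQ : Dfn Q) : Dfn fun v => P v ∧ Q v :=
  Definable.inter hP hQ

theorem Dfn.or {P Q : (α → M) → Prop} (hP : Dfn P) (hQ : Dfn Q) : Dfn fun v => P v ∨ Q v :=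
  Definable.union hP hQ

theorem Dfn.not {P : (α → M) → Prop} (hP : Dfn P) : Dfn fun v => ¬ P v :=
  Definable.compl hP

theorem Dfn.imp {P Q : (α → M) → Prop} (hP : Dfn P) (hQ : Dfn Q) : Dfn fun v => P v → Q v := by
  simpa only [imp_iff_not_or] using hP.not.or hQ

theorem Dfn.iff {P Q : (α → M) → Prop} (hP : Dfn P) (hQ : Dfn Q) : Dfn fun v => P v ↔ Q v := by
  simpa only [iff_iff_implies_and_implies] using (hP.imp hQ).and (hQ.imp hP)

theorem Dfn.ex {Q : (α → M) → M → Prop}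
    (h : Dfn fun w : α ⊕ Fin 1 → M => Q (fun a => w (Sum.inl a)) (w (Sum.inr 0))) :
    Dfn fun v => ∃ x, Q v x := by
  have := Definable.exists_of_finite h
  unfold Dfn
  convert this using 1
  ext v
  constructor
  · rintro ⟨x, hx⟩
    exact ⟨fun _ => x, hx⟩
  · rintro ⟨x, hx⟩
    exact ⟨x 0, hx⟩

theorem Dfn.all {Q : (α → M) → M → Prop}
    (h : Dfn fun w : α ⊕ Fin 1 → M => Q (fun a => w (Sum.inl a)) (w (Sum.inr 0))) :
    Dfn fun v => ∀ x, Q v x := by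
  have h1 : Dfn fun v => ∃ x, ¬ Q v x := Dfn.ex h.not
  simpa only [not_exists, not_not] using h1.not

theorem Dfn.isUnorderedPair {a x y : (α → M) → M} (ha : IsTerm a) (hx : IsTerm x)
    (hy : IsTerm y) : Dfn fun v => IsUnorderedPair (a v) (x v) (y v) :=
  .all (.iff (.mem (.var _) ha.weaken) (.or (.eq (.var _) hx.weaken) (.eq (.var _) hy.weaken)))

theorem Dfn.isOrderedPair {p x y : (α → M) → M} (hp : IsTerm p) (hx : IsTerm x) (hy : IsTerm y) :
    Dfn fun v => IsOrderedPair (p v) (x v) (y v) :=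
  .ex (.ex (.and (.isUnorderedPair (.var _) hx.weaken.weaken hx.weaken.weaken)
    (.and (.isUnorderedPair (.var _) hx.weaken.weaken hy.weaken.weaken)
      (.isUnorderedPair hp.weaken.weaken (.var _) (.var _)))))

theorem Dfn.pairMem {r x y : (α → M) → M} (hr : IsTerm r) (hx : IsTerm x) (hy : IsTerm y) :
    Dfn fun v => PairMem (r v) (x v) (y v) :=
  .ex (.and (.isOrderedPair (.var _) hx.weaken hy.weaken) (.mem (.var _) hr.weaken))

theorem Dfn.isEmptySet {a : (α → M) → M} (ha : IsTerm a) : Dfn fun v => IsEmptySet (a v) :=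
  .all (.not (.mem (.var _) ha.weaken))

theorem Dfn.isSuccessor {s x : (α → M) → M} (hs : IsTerm s) (hx : IsTerm x) :
    Dfn fun v => IsSuccessor (s v) (x v) :=
  .all (.iff (.mem (.var _) hs.weaken) (.or (.mem (.var _) hx.weaken) (.eq (.var _) hx.weaken)))

theorem Dfn.isInductiveSet {w : (α → M) → M} (hw : IsTerm w) :
    Dfn fun v => IsInductiveSet (w v) :=
  .and (.ex (.and (.isEmptySet (.var _)) (.mem (.var _) hw.weaken)))
    (.all (.imp (.mem (.var _) hw.weaken)
      (.ex (.and (.isSuccessor (.var _) (.var _)) (.mem (.var _) hw.weaken.weaken)))))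

end Definability

variable {M : Type u} [setLang.Structure M]

/-! ### Ordered pairs and finite sequences in an arbitrary structure -/

theorem IsUnorderedPair.eq_or_eq {a x y x' y' : M} (h : IsUnorderedPair a x y)
    (h' : IsUnorderedPair a x' y') : (x = x' ∧ y = y') ∨ (x = y' ∧ y = x') := by
  have h1 := (h' x).1 ((h x).2 (Or.inl rfl))
  have h2 := (h' y).1 ((h y).2 (Or.inr rfl))
  have h3 := (h x').1 ((h' x').2 (Or.inl rfl))
  have h4 := (h y').1 ((h' y').2 (Or.inr rfl))
  grind

theorem IsOrderedPair.inj {p x y x' y' : M} (h : IsOrderedPair p x y)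
    (h' : IsOrderedPair p x' y') : x = x' ∧ y = y' := by
  obtain ⟨u, v, hu, hv, hp⟩ := h
  obtain ⟨u', v', hu', hv', hq⟩ := h'
  rcases hp.eq_or_eq hq with ⟨rfl, rfl⟩ | ⟨rfl, rfl⟩
  · have h1 := hu.eq_or_eq hu'
    have h2 := hv.eq_or_eq hv'
    grind
  · have h1 := hu.eq_or_eq hv'
    have h2 := hv.eq_or_eq hu'
    grind

theorem IsSuccessor.lt {s n : Omega M} (h : IsSuccessor s.1 n.1) : n < s :=
  (h n.1).2 (Or.inr rfl)

theorem FinSeq.pairMem_mem {n : Omega M} (s : FinSeq n) {x y : M} (h : PairMem s.1 x y) :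
    Mem y n.1 := by
  obtain ⟨m, -, hs⟩ := s.2
  obtain ⟨p, hp, hps⟩ := h
  obtain ⟨x', y', -, hy', hp'⟩ := hs.1 p hps
  rwa [(hp.inj hp').2]

theorem FinSeq.pairMem_unique {n : Omega M} (s : FinSeq n) {x y y' : M} (h : PairMem s.1 x y)
    (h' : PairMem s.1 x y') : y = y' := by
  obtain ⟨m, -, hs⟩ := s.2
  obtain ⟨p, hp, hps⟩ := h
  obtain ⟨x₁, y₁, hx₁, -, hp'⟩ := hs.1 p hps
  rw [← (hp.inj hp').1] at hx₁
  exact (hs.2 x hx₁).unique ⟨p, hp, hps⟩ h'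

variable [hM : Fact (IsZFCMinus M)]

theorem ext {a b : M} (h : ∀ x, Mem x a ↔ Mem x b) : a = b := hM.out.extensionality a b h

theorem exists_sep (a : M) {P : M → Prop} (hP : Dfn fun v : Fin 1 → M => P (v 0)) :
    ∃ b, ∀ x, Mem x b ↔ Mem x a ∧ P x :=
  hM.out.separation {x | P x} hP a

/-! ### Existence and uniqueness of ordered pairs -/

theorem exists_isOrderedPair (x y : M) : ∃ p, IsOrderedPair p x y := by
  obtain ⟨u, hu⟩ := hM.out.pairing x x
  obtain ⟨v, hv⟩ := hM.out.pairing x y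
  obtain ⟨p, hp⟩ := hM.out.pairing u v
  exact ⟨p, u, v, hu, hv, hp⟩

theorem IsUnorderedPair.unique {a b x y : M} (h : IsUnorderedPair a x y)
    (h' : IsUnorderedPair b x y) : a = b :=
  ext fun z => (h z).trans (h' z).symm

theorem IsOrderedPair.unique {p q x y : M} (h : IsOrderedPair p x y) (h' : IsOrderedPair q x y) :
    p = q := by
  obtain ⟨u, v, hu, hv, hp⟩ := h
  obtain ⟨u', v', hu', hv', hq⟩ := h'
  obtain rfl := hu.unique hu'
  obtain rfl := hv.unique hv'
  exact hp.unique hq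

/-! ### The natural numbers -/

theorem exists_omega : ∃ w : M, ∀ x, Mem x w ↔ ∀ w', IsInductiveSet w' → Mem x w' := by
  obtain ⟨w₀, hw₀⟩ := hM.out.infinity
  obtain ⟨w, hw⟩ := exists_sep w₀ (P := fun x => ∀ w', IsInductiveSet w' → Mem x w')
    (.all (.imp (.isInductiveSet (.var _)) (.mem (.var _) (.var _))))
  exact ⟨w, fun x => (hw x).trans ⟨fun h => h.2, fun h => ⟨h w₀ hw₀, h⟩⟩⟩

variable (M) in
/-- The set of natural numbers of the model. -/
def omega : M := exists_omega.choose

theorem mem_omega {x : M} : Mem x (omega M) ↔ ∀ w, IsInductiveSet w → Mem x w :=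
  exists_omega.choose_spec x

theorem Omega.mem (n : Omega M) : Mem n.1 (omega M) := mem_omega.2 n.2

theorem IsEmptySet.mem_omega {e : M} (he : IsEmptySet e) : Mem e (omega M) :=
  SetModel.mem_omega.2 fun w hw => by
    obtain ⟨e', he', h⟩ := hw.1
    rwa [ext (a := e) (b := e') fun x => ⟨fun h => (he x h).elim, fun h => (he' x h).elim⟩]

theorem IsSuccessor.mem_omega {s x : M} (hs : IsSuccessor s x) (hx : Mem x (omega M)) :
    Mem s (omega M) :=
  SetModel.mem_omega.2 fun w hw => by
    obtain ⟨s', hs', h⟩ := hw.2 x (SetModel.mem_omega.1 hx w hw)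
    rwa [ext (a := s) (b := s') fun z => (hs z).trans (hs' z).symm]

theorem exists_isSuccessor {x : M} (hx : Mem x (omega M)) : ∃ s, IsSuccessor s x := by
  obtain ⟨w, hw⟩ := hM.out.infinity
  obtain ⟨s, hs, -⟩ := hw.2 x (mem_omega.1 hx w hw)
  exact ⟨s, hs⟩

theorem omega_induction {P : M → Prop} (hP : Dfn fun v : Fin 1 → M => P (v 0))
    (h0 : ∀ e, IsEmptySet e → P e)
    (hs : ∀ x s, Mem x (omega M) → P x → IsSuccessor s x → P s) {x : M}
    (hx : Mem x (omega M)) : P x := by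
  obtain ⟨b, hb⟩ := exists_sep (omega M) hP
  refine ((hb x).1 (mem_omega.1 hx b ⟨?_, ?_⟩)).2
  · obtain ⟨w, hw⟩ := hM.out.infinity
    obtain ⟨e, he, -⟩ := hw.1
    exact ⟨e, he, (hb e).2 ⟨he.mem_omega, h0 e he⟩⟩
  · intro y hy
    obtain ⟨hy, hPy⟩ := (hb y).1 hy
    obtain ⟨s, h⟩ := exists_isSuccessor hy
    exact ⟨s, h, (hb s).2 ⟨h.mem_omega hy, hs y s hy hPy h⟩⟩

/-- Foundation, for definable sets of natural numbers. -/
theorem exists_mem_minimal {P : M → Prop} (hP : Dfn fun v : Fin 1 → M => P (v 0))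
    (h : ∃ x, Mem x (omega M) ∧ P x) :
    ∃ x, Mem x (omega M) ∧ P x ∧ ∀ y, Mem y (omega M) → P y → ¬ Mem y x := by
  obtain ⟨b, hb⟩ := exists_sep (omega M) hP
  obtain ⟨x, hx⟩ := h
  obtain ⟨y, hy, hmin⟩ := hM.out.foundation b ⟨x, (hb x).2 hx⟩
  exact ⟨y, ((hb y).1 hy).1, ((hb y).1 hy).2, fun z hz hPz => hmin z ((hb z).2 ⟨hz, hPz⟩)⟩

theorem mem_trans_of_mem_omega {x y z : M} (hx : Mem x (omega M)) (hy : Mem y x) (hz : Mem z y) :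
    Mem z x := by
  refine omega_induction (P := fun x => ∀ y, Mem y x → ∀ z, Mem z y → Mem z x)
    (.all (.imp (.mem (.var _) (.var _)) (.all (.imp (.mem (.var _) (.var _))
      (.mem (.var _) (.var _)))))) ?_ ?_ hx y hy z hz
  · exact fun e he y hy => (he y hy).elim
  · intro x s _ ih hs y hy z hz
    rcases (hs y).1 hy with h | rfl
    · exact (hs z).2 (Or.inl (ih y h z hz))
    · exact (hs z).2 (Or.inl hz)

theorem mem_omega_of_mem {x y : M} (hx : Mem x (omega M)) (hy : Mem y x) : Mem y (omega M) := by
  refine omega_induction (P := fun x => ∀ y, Mem y x → Mem y (omega M))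
    (.all (.imp (.mem (.var _) (.var _)) (.mem (.var _) (.const _)))) ?_ ?_ hx y hy
  · exact fun e he y hy => (he y hy).elim
  · intro x s hx ih hs y hy
    rcases (hs y).1 hy with h | rfl
    · exact ih y h
    · exact hx

theorem not_mem_self_of_mem_omega {x : M} (hx : Mem x (omega M)) : ¬ Mem x x := by
  obtain ⟨y, hy, rfl, h⟩ := exists_mem_minimal (P := fun y => y = x) (.eq (.var _) (.const _))
    ⟨x, hx, rfl⟩
  exact h _ hy rfl

/-- Any two natural numbers are comparable: take a minimal `x` that is incomparable to some natural
number, and then a minimal `y` that is incomparable to `x`; they have the same elements. -/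
theorem mem_trichotomous {x y : M} (hx : Mem x (omega M)) (hy : Mem y (omega M)) :
    Mem x y ∨ x = y ∨ Mem y x := by
  by_contra hcon
  obtain ⟨x, hx, ⟨y, hy, hxy⟩, hxmin⟩ := exists_mem_minimal
    (P := fun x => ∃ y, Mem y (omega M) ∧ ¬ (Mem x y ∨ x = y ∨ Mem y x))
    (.ex (.and (.mem (.var _) (.const _)) (.not (.or (.mem (.var _) (.var _))
      (.or (.eq (.var _) (.var _)) (.mem (.var _) (.var _))))))) ⟨x, hx, y, hy, hcon⟩
  obtain ⟨y, hy, hxy, hymin⟩ := exists_mem_minimal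
    (P := fun y => ¬ (Mem x y ∨ x = y ∨ Mem y x))
    (.not (.or (.mem (.const _) (.var _))
      (.or (.eq (.const _) (.var _)) (.mem (.var _) (.const _))))) ⟨y, hy, hxy⟩
  refine hxy (Or.inr (Or.inl (ext fun z => ⟨fun hz => ?_, fun hz => ?_⟩)))
  · by_contra hzy
    refine hxmin z (mem_omega_of_mem hx hz) ⟨y, hy, ?_⟩ hz
    rintro (h | rfl | h)
    · exact hzy h
    · exact hxy (Or.inr (Or.inr hz))
    · exact hxy (Or.inr (Or.inr (mem_trans_of_mem_omega hx hz h)))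
  · by_contra hzx
    refine hymin z (mem_omega_of_mem hy hz) ?_ hz
    rintro (h | rfl | h)
    · exact hxy (Or.inl (mem_trans_of_mem_omega hy hz h))
    · exact hxy (Or.inl hz)
    · exact hzx h

instance Omega.instLinearOrder : LinearOrder (Omega M) where
  le m n := m < n ∨ m = n
  lt m n := m < n
  le_refl _ := Or.inr rfl
  le_trans a b c := by
    rintro (h | rfl) (h' | rfl)
    · exact Or.inl (mem_trans_of_mem_omega c.mem h' h)
    · exact Or.inl h
    · exact Or.inl h'
    · exact Or.inr rfl
  lt_iff_le_not_ge a b := by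
    constructor
    · intro h
      refine ⟨Or.inl h, ?_⟩
      rintro (h' | rfl)
      · exact not_mem_self_of_mem_omega a.mem (mem_trans_of_mem_omega a.mem h' h)
      · exact not_mem_self_of_mem_omega b.mem h
    · rintro ⟨h | rfl, h'⟩
      · exact h
      · exact (h' (Or.inr rfl)).elim
  le_antisymm a b := by
    rintro (h | rfl) (h' | h')
    · exact (not_mem_self_of_mem_omega a.mem (mem_trans_of_mem_omega a.mem h' h)).elim
    · exact h'.symm
    · rfl
    · rfl
  le_total a b := by
    rcases mem_trichotomous a.mem b.mem with h | h | h
    · exact Or.inl (Or.inl h)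
    · exact Or.inl (Or.inr (Subtype.ext h))
    · exact Or.inr (Or.inl h)
  toDecidableLE := Classical.decRel _

theorem Omega.le_iff {m n : Omega M} : m ≤ n ↔ Mem m.1 n.1 ∨ m.1 = n.1 :=
  or_congr Iff.rfl Subtype.ext_iff

/-- A member of a natural number, as a natural number. -/
def Omega.ofMem {n : Omega M} {x : M} (h : Mem x n.1) : Omega M :=
  ⟨x, mem_omega.1 (mem_omega_of_mem n.mem h)⟩

theorem Omega.exists_isSuccessor (n : Omega M) : ∃ s : Omega M, IsSuccessor s.1 n.1 := by
  obtain ⟨s, hs⟩ := SetModel.exists_isSuccessor n.mem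
  exact ⟨⟨s, mem_omega.1 (hs.mem_omega n.mem)⟩, hs⟩

theorem IsSuccessor.covBy {s n : Omega M} (h : IsSuccessor s.1 n.1) : n ⋖ s := by
  refine ⟨h.lt, fun c h1 h2 => ?_⟩
  exact absurd (Omega.le_iff.2 ((h c.1).1 h2)) (not_le.2 h1)

theorem Omega.exists_covBy (n : Omega M) : ∃ s, n ⋖ s := by
  obtain ⟨s, hs⟩ := n.exists_isSuccessor
  exact ⟨s, hs.covBy⟩

theorem Omega.exists_covBy_of_lt {m n : Omega M} (h : m < n) : ∃ k, k ⋖ n := by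
  have key : IsEmptySet n.1 ∨ ∃ k, Mem k (omega M) ∧ IsSuccessor n.1 k := by
    refine omega_induction (P := fun n => IsEmptySet n ∨ ∃ k, Mem k (omega M) ∧ IsSuccessor n k)
      ?_ ?_ ?_ n.mem
    · exact .or (.isEmptySet (.var _)) (.ex (.and (.mem (.var _) (.const _))
        (.isSuccessor (.var _) (.var _))))
    · exact fun e he => Or.inl he
    · exact fun x s hx _ hs => Or.inr ⟨x, hx, hs⟩
  rcases key with h0 | ⟨k, hk, hs⟩
  · exact (h0 _ h).elim
  · exact ⟨⟨k, mem_omega.1 hk⟩, IsSuccessor.covBy hs⟩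

theorem Omega.exists_least {P : M → Prop} (hP : Dfn fun v : Fin 1 → M => P (v 0))
    (h : ∃ x : Omega M, P x.1) : ∃ x : Omega M, P x.1 ∧ ∀ y : Omega M, P y.1 → x ≤ y := by
  obtain ⟨x, hx⟩ := h
  obtain ⟨y, hy, hPy, hmin⟩ := exists_mem_minimal hP ⟨x.1, x.mem, hx⟩
  exact ⟨⟨y, mem_omega.1 hy⟩, hPy, fun z hz => not_lt.1 fun hlt => hmin z.1 z.mem hz hlt⟩

theorem Omega.exists_greatest {P : M → Prop} (hP : Dfn fun v : Fin 1 → M => P (v 0))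
    (h : ∃ x : Omega M, P x.1) (n : Omega M) (hn : ∀ x : Omega M, P x.1 → x ≤ n) :
    ∃ x : Omega M, P x.1 ∧ ∀ y : Omega M, P y.1 → y ≤ x := by
  obtain ⟨u, hu, hmin⟩ := Omega.exists_least
    (P := fun u => ∀ y, Mem y (omega M) → P y → Mem y u ∨ y = u)
    (.all (.imp (.mem (.var _) (.const _)) (.imp
      (Definable.preimage_comp (fun _ => Sum.inr 0) hP)
      (.or (.mem (.var _) (.var _)) (.eq (.var _) (.var _))))))
    ⟨n, fun y hy hPy => Omega.le_iff.1 (hn ⟨y, mem_omega.1 hy⟩ hPy)⟩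
  have hub : ∀ y : Omega M, P y.1 → y ≤ u := fun y hy => Omega.le_iff.2 (hu y.1 y.mem hy)
  refine ⟨u, ?_, hub⟩
  by_contra hPu
  have hlt : ∀ y : Omega M, P y.1 → y < u := fun y hy =>
    lt_of_le_of_ne (hub y hy) fun e => hPu (e ▸ hy)
  obtain ⟨x, hx⟩ := h
  obtain ⟨k, hk⟩ := Omega.exists_covBy_of_lt (hlt x hx)
  exact absurd (hmin k fun y hy hPy => Omega.le_iff.1
    (hk.le_of_lt (hlt ⟨y, mem_omega.1 hy⟩ hPy))) (not_le.2 hk.lt)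

/-! ### Finite sequences of the model -/

/-- Inclusion of finite sequences is inclusion of graphs, as all their elements are ordered pairs. -/
theorem FinSeq.le_iff {n : Omega M} {s t : FinSeq n} :
    s ≤ t ↔ ∀ x y, PairMem s.1 x y → PairMem t.1 x y := by
  constructor
  · rintro h x y ⟨p, hp, hps⟩
    exact ⟨p, hp, h p hps⟩
  · intro h p hps
    obtain ⟨m, -, hs⟩ := s.2
    obtain ⟨x, y, -, -, hp⟩ := hs.1 p hps
    obtain ⟨q, hq, hqt⟩ := h x y ⟨p, hp, hps⟩
    rwa [hp.unique hq]

/-- Replacement: a definable function on a natural number `m` is a set of the model. -/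
theorem FinSeq.exists_of_dfn {n m : Omega M} (hm : m < n) {R : M → M → Prop}
    (hR : Dfn fun v : Fin 2 → M => R (v 0) (v 1)) (hfun : ∀ x, Mem x m.1 → ∃! y, R x y)
    (hn : ∀ x y, Mem x m.1 → R x y → Mem y n.1) :
    ∃ s : FinSeq n, ∀ x y, PairMem s.1 x y ↔ Mem x m.1 ∧ R x y := by
  have hR' : ∀ {α : Type} (i j : α), Dfn fun v : α → M => R (v i) (v j) := fun i j =>
    Definable.preimage_comp ![i, j] hR
  obtain ⟨b, hb⟩ := hM.out.collection {q | ∃ y, IsOrderedPair q.2 q.1 y ∧ R q.1 y}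
    (show Dfn fun v : Fin 2 → M => ∃ y, IsOrderedPair (v 1) (v 0) y ∧ R (v 0) y from
      .ex (.and (.isOrderedPair (.var _) (.var _) (.var _)) (hR' (Sum.inl 0) (Sum.inr 0)))) m.1
    fun x hx => by
      obtain ⟨y, hy, -⟩ := hfun x hx
      obtain ⟨p, hp⟩ := exists_isOrderedPair x y
      exact ⟨p, y, hp, hy⟩
  obtain ⟨s, hs⟩ := exists_sep b
    (P := fun p => ∃ x, ∃ y, Mem x m.1 ∧ IsOrderedPair p x y ∧ R x y)
    (.ex (.ex (.and (.mem (.var _) (.const _)) (.and (.isOrderedPair (.var _) (.var _) (.var _))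
      (hR' (Sum.inl (Sum.inr 0)) (Sum.inr 0))))))
  have key : ∀ x y, PairMem s x y ↔ Mem x m.1 ∧ R x y := by
    intro x y
    constructor
    · rintro ⟨p, hp, hps⟩
      obtain ⟨-, x', y', hx', hp', h⟩ := (hs p).1 hps
      obtain ⟨rfl, rfl⟩ := hp.inj hp'
      exact ⟨hx', h⟩
    · rintro ⟨hx, h⟩
      obtain ⟨p, hpb, y', hp, h'⟩ := hb x hx
      obtain rfl := (hfun x hx).unique h h'
      exact ⟨p, hp, (hs p).2 ⟨hpb, x, y, hx, hp, h⟩⟩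
  refine ⟨⟨s, m, hm, ?_, ?_⟩, key⟩
  · intro p hps
    obtain ⟨-, x, y, hx, hp, h⟩ := (hs p).1 hps
    exact ⟨x, y, hx, hn x y hx h, hp⟩
  · intro x hx
    obtain ⟨y, hy, huniq⟩ := hfun x hx
    exact ⟨y, (key x y).2 ⟨hx, hy⟩, fun z hz => huniq z ((key x z).1 hz).2⟩

/-! ### Uniqueness of the cofinality on the other side of a cut -/

section Uniqueness

variable {M : Type u} [setLang.Structure M]

/-- The order of the natural numbers of the model (`d = true`) or its reverse (`d = false`), as a
relation on the whole model. -/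
def DirLE (d : Bool) (x y : M) : Prop :=
  match d with
  | true => Mem x y ∨ x = y
  | false => Mem y x ∨ x = y

theorem Dfn.dirLE {α : Type} (d : Bool) {s t : (α → M) → M} (hs : IsTerm s) (ht : IsTerm t) :
    Dfn fun v => DirLE d (s v) (t v) := by
  cases d
  · exact .or (.mem ht hs) (.eq hs ht)
  · exact .or (.mem hs ht) (.eq hs ht)

variable [hM : Fact (IsZFCMinus M)]

/-- There is a finite sequence `t` with domain `{x | x ≤ c}` which below `c` agrees with `s` wherever
the value of `s` is defined and at most `v` in the direction `d`, and whose other values, in particular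
the one at `c`, are `v`. -/
theorem FinSeq.exists_truncate {n c v : Omega M} (d : Bool) (hc : ∃ c', c < c' ∧ c' < n)
    (hv : v < n) (s : FinSeq n) :
    ∃ t : FinSeq n, ∀ x y, PairMem t.1 x y ↔ (Mem x c.1 ∨ x = c.1) ∧
      ((Mem x c.1 ∧ PairMem s.1 x y ∧ DirLE d y v.1) ∨
        ((¬ ∃ z, Mem x c.1 ∧ PairMem s.1 x z ∧ DirLE d z v.1) ∧ y = v.1)) := by
  obtain ⟨c', hcc', hc'n⟩ := hc
  obtain ⟨e, he⟩ := c.exists_isSuccessor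
  have hen : e < n := lt_of_le_of_lt (he.covBy.ge_of_gt hcc') hc'n
  obtain ⟨t, ht⟩ := FinSeq.exists_of_dfn hen
    (R := fun x y => (Mem x c.1 ∧ PairMem s.1 x y ∧ DirLE d y v.1) ∨
        ((¬ ∃ z, Mem x c.1 ∧ PairMem s.1 x z ∧ DirLE d z v.1) ∧ y = v.1))
    (.or (.and (.mem (.var _) (.const _)) (.and (.pairMem (.const _) (.var _) (.var _))
        (.dirLE d (.var _) (.const _))))
      (.and (.not (.ex (.and (.mem (.var _) (.const _))
        (.and (.pairMem (.const _) (.var _) (.var _)) (.dirLE d (.var _) (.const _))))))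
        (.eq (.var _) (.const _))))
    (by
      intro x _
      by_cases h : ∃ z, Mem x c.1 ∧ PairMem s.1 x z ∧ DirLE d z v.1
      · obtain ⟨z, hz⟩ := h
        refine ⟨z, Or.inl hz, ?_⟩
        rintro y (hy | hy)
        · exact s.pairMem_unique hy.2.1 hz.2.1
        · exact absurd ⟨z, hz⟩ hy.1
      · refine ⟨v.1, Or.inr ⟨h, rfl⟩, ?_⟩
        rintro y (hy | hy)
        · exact absurd ⟨y, hy⟩ h
        · exact hy.2)
    (by
      rintro x y _ (hy | hy)
      · exact s.pairMem_mem hy.2.1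
      · exact hy.2 ▸ hv)
  exact ⟨t, fun x y => (ht x y).trans (and_congr_left' (he x))⟩

/-- Let `L` be the order of the natural numbers of the model or its reverse, presented by `φ`. If
all short increasing sequences are bounded in the trees of finite sequences, then for bounded
increasing `κ`-sequences `a` of natural numbers and `a'` in `L` there is a finite sequence `t` of the
model which maps each `a α` to `a' α` and whose values up to `a α` are at most `a' α` in the order of
`L`. -/
theorem FinSeq.exists_interpolation {L : Type u} [LinearOrder L] {d : Bool} {φ : L → Omega M}
    (hφ : ∀ x y, x ≤ y ↔ DirLE d (φ x).1 (φ y).1) {κ : Cardinal.{u}} (hκ : κ.IsRegular)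
    (hT : ∀ n : Omega M, ∀ μ : Cardinal.{u}, μ.IsRegular → μ ≤ κ →
      ∀ s : Iio μ.ord → FinSeq n, StrictMono s → ∃ t, ∀ α, s α ≤ t)
    {a : Iio κ.ord → Omega M} {a' : Iio κ.ord → L} (ha : StrictMono a) (ha' : StrictMono a')
    {n : Omega M} (hn : ∀ α, a α < n) (hn' : ∀ α, φ (a' α) < n)
    (hvals : ∀ y : M, Mem y n.1 → ∃ x : L, (φ x).1 = y) :
    ∃ t : FinSeq n, (∀ α, PairMem t.1 (a α).1 (φ (a' α)).1) ∧
      ∀ α x, Mem x (a α).1 ∨ x = (a α).1 → ∃ y, PairMem t.1 x y ∧ DirLE d y (φ (a' α)).1 := by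
  have htrans : ∀ {y : M} {β α}, Mem y n.1 → β < α → DirLE d y (φ (a' β)).1 →
      DirLE d y (φ (a' α)).1 := by
    intro y β α hy hβ h
    obtain ⟨x, rfl⟩ := hvals y hy
    exact (hφ _ _).1 (((hφ _ _).2 h).trans (ha' hβ).le)
  have hsucc : ∀ α, ∃ c', a α < c' ∧ c' < n := fun α => by
    obtain ⟨β, hβ⟩ := hκ.exists_gt α
    exact ⟨a β, ha hβ, hn β⟩
  have : Nonempty (FinSeq n) := by
    obtain ⟨α⟩ := hκ.nonempty_Iio
    obtain ⟨s, -⟩ := FinSeq.exists_of_dfn (hn α) (R := fun _ y => y = (a α).1)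
      (.eq (.var _) (.const _)) (fun _ _ => ⟨_, rfl, fun _ h => h⟩) fun _ _ _ h => h ▸ hn α
    exact ⟨s⟩
  obtain ⟨f, hf, hlt⟩ := exists_seq_of_step (I := Iio κ.ord) (T := FinSeq n)
    (fun α t => (∀ x, (∃ y, PairMem t.1 x y) ↔ Mem x (a α).1 ∨ x = (a α).1) ∧
      PairMem t.1 (a α).1 (φ (a' α)).1 ∧ ∀ x y, PairMem t.1 x y → DirLE d y (φ (a' α)).1)
    (· < ·) (by
      intro α f hP hR
      obtain ⟨u, hu⟩ := exists_upper_bound_of_initial_segment (hT n) α f hR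
      -- the bound `u` may be wild above the earlier stages, so it is cut down to values `≤ a' α`
      obtain ⟨t, ht⟩ := u.exists_truncate d (hsucc α) (hn' α)
      have hnot : ¬ Mem (a α).1 (a α).1 := not_mem_self_of_mem_omega (a α).mem
      have hval : PairMem t.1 (a α).1 (φ (a' α)).1 :=
        (ht _ _).2 ⟨Or.inr rfl, Or.inr ⟨fun ⟨_, h, _⟩ => hnot h, rfl⟩⟩
      refine ⟨t, ⟨fun x => ⟨fun ⟨y, hy⟩ => ((ht x y).1 hy).1, fun hx => ?_⟩, hval, ?_⟩, ?_⟩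
      · by_cases h : ∃ z, Mem x (a α).1 ∧ PairMem u.1 x z ∧ DirLE d z (φ (a' α)).1
        · obtain ⟨z, hz⟩ := h
          exact ⟨z, (ht x z).2 ⟨hx, Or.inl hz⟩⟩
        · exact ⟨_, (ht x _).2 ⟨hx, Or.inr ⟨h, rfl⟩⟩⟩
      · intro x y hxy
        rcases ((ht x y).1 hxy).2 with h | h
        · exact h.2.2
        · rw [h.2]
          exact (hφ _ _).1 le_rfl
      · intro j hj
        refine lt_of_le_not_ge (FinSeq.le_iff.2 fun x y hxy => ?_) fun hle => ?_
        · have hx : Mem x (a α).1 := by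
            rcases ((hP j hj).1 x).1 ⟨y, hxy⟩ with h | rfl
            · exact mem_trans_of_mem_omega (a α).mem (ha hj) h
            · exact ha hj
          exact (ht x y).2 ⟨Or.inl hx, Or.inl ⟨hx, FinSeq.le_iff.1 (hu j hj) x y hxy,
            htrans ((f j).pairMem_mem hxy) hj ((hP j hj).2.2 x y hxy)⟩⟩
        · have := ((hP j hj).1 _).1 ⟨_, FinSeq.le_iff.1 hle _ _ hval⟩
          exact absurd (Omega.le_iff.2 this) (not_le.2 (ha hj)))
  obtain ⟨t, ht⟩ := hT n κ hκ le_rfl f fun i j h => hlt i j h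
  refine ⟨t, fun α => FinSeq.le_iff.1 (ht α) _ _ (hf α).2.1, fun α x hx => ?_⟩
  obtain ⟨y, hy⟩ := ((hf α).1 x).2 hx
  exact ⟨y, FinSeq.le_iff.1 (ht α) _ _ hy, (hf α).2.2 x y hy⟩

/-- A `(κ, μ)`-cut in the natural numbers of the model and a `(κ, ν)`-cut in the same order or its
reverse have `μ = ν`. The relation "the values of `t` up to `e` are at most `y`", for a finite
sequence `t` that carries one lower half to the other, compares the two upper halves. -/
theorem right_cofinality_unique {L : Type u} [LinearOrder L] {d : Bool} {φ : L → Omega M}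
    (hφ : ∀ x y, x ≤ y ↔ DirLE d (φ x).1 (φ y).1) (hsurj : Function.Surjective φ)
    (hpred : ∀ x y : L, x < y → ∃ z, z ⋖ y)
    {κ : Cardinal.{u}}
    (hT : ∀ n : Omega M, ∀ μ : Cardinal.{u}, μ.IsRegular → μ ≤ κ →
      ∀ s : Iio μ.ord → FinSeq n, StrictMono s → ∃ t, ∀ α, s α ≤ t)
    {μ ν : Cardinal.{u}} (h₁ : (κ, μ) ∈ cutSpectrum (Omega M)) (h₂ : (κ, ν) ∈ cutSpectrum L) :
    μ = ν := by
  obtain ⟨hκ, hμ, a, b, hcut⟩ := h₁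
  obtain ⟨-, hν, a', b', hcut'⟩ := h₂
  obtain ⟨ha, hb, hab, hco⟩ := (isCut_iff hκ hμ).1 hcut
  obtain ⟨ha', hb', hab', hco'⟩ := (isCut_iff hκ hν).1 hcut'
  obtain ⟨α₀⟩ := hκ.nonempty_Iio
  obtain ⟨β₀⟩ := hμ.nonempty_Iio
  obtain ⟨β₀'⟩ := hν.nonempty_Iio
  -- a number above everything that occurs in `a` and `a'`
  obtain ⟨n, hn, hn'⟩ : ∃ n, (∀ α, a α < n) ∧ ∀ α, φ (a' α) < n := by
    have hbound : ∃ m, ∀ α, φ (a' α) ≤ m := by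
      cases d
      · refine ⟨φ (a' ⟨0, hκ.ord_pos⟩), fun α => ?_⟩
        have h0 : a' ⟨0, hκ.ord_pos⟩ ≤ a' α :=
          ha'.monotone (show (0 : Ordinal) ≤ α.1 from zero_le)
        have := (hφ _ _).1 h0
        exact Omega.le_iff.2 (this.imp_right Eq.symm)
      · exact ⟨φ (b' β₀'), fun α => Omega.le_iff.2 ((hφ _ _).1 (hab' α β₀').le)⟩
    obtain ⟨m, hm⟩ := hbound
    obtain ⟨s, hs⟩ := (max m (b β₀)).exists_covBy
    exact ⟨s, fun α => (hab α β₀).trans_le ((le_max_right _ _).trans hs.le),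
      fun α => (hm α).trans_lt ((le_max_left _ _).trans_lt hs.lt)⟩
  have hval : ∀ (k : Omega M) (y : M), Mem y k.1 → ∃ x : L, (φ x).1 = y := fun k y hy => by
    obtain ⟨x, hx⟩ := hsurj (Omega.ofMem hy)
    exact ⟨x, by rw [hx]; rfl⟩
  obtain ⟨t, ht, hts⟩ := FinSeq.exists_interpolation hφ hκ hT ha ha' hn hn' (hval n)
  let E : M → M → Prop := fun e y => ∀ x, Mem x e ∨ x = e → ∃ z, PairMem t.1 x z ∧ DirLE d z y
  have hEdfn : ∀ {α : Type} {e y : (α → M) → M}, IsTerm e → IsTerm y →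
      Dfn fun v => E (e v) (y v) := fun he hy =>
    .all (.imp (.or (.mem (.var _) he.weaken) (.eq (.var _) he.weaken))
      (.ex (.and (.pairMem (.const _) (.var _) (.var _)) (.dirLE d (.var _) hy.weaken.weaken))))
  have hE₁ : ∀ (x x' : Omega M) (y : L), x' ≤ x → E x.1 (φ y).1 → E x'.1 (φ y).1 := by
    intro x x' y hx h z hz
    refine h z ?_
    rcases Omega.le_iff.1 hx with h' | h'
    · rcases hz with hz | rfl
      · exact Or.inl (mem_trans_of_mem_omega x.mem h' hz)
      · exact Or.inl h'
    · exact h' ▸ hz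
  have hE₂ : ∀ (x : Omega M) (y y' : L), y ≤ y' → E x.1 (φ y).1 → E x.1 (φ y').1 := by
    intro x y y' hy h z hz
    obtain ⟨w, hw, hwy⟩ := h z hz
    obtain ⟨w, rfl⟩ := hval n w (t.pairMem_mem hw)
    exact ⟨_, hw, (hφ _ _).1 (((hφ _ _).2 hwy).trans hy)⟩
  refine coinitiality_eq_of_relation hμ hν (U₁ := {x | ∀ α, a α < x}) (U₂ := {y | ∀ α, a' α < y})
    hb hb' (fun β α => hab α β) (fun β α => hab' α β) hco hco'
    (fun x y => E x.1 (φ y).1) hE₁ hE₂ ?_ ?_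
  · -- overspill: `E · y` holds at every `a α`, hence further up
    intro y hy
    have hlow : ∀ α, E (a α).1 (φ y).1 := by
      intro α x hx
      obtain ⟨z, hz, hzle⟩ := hts α x hx
      obtain ⟨z, rfl⟩ := hval n z (t.pairMem_mem hz)
      exact ⟨_, hz, (hφ _ _).1 (((hφ _ _).2 hzle).trans (hy α).le)⟩
    by_cases hex : ∃ x : Omega M, ¬ E x.1 (φ y).1
    · obtain ⟨e, he, hmin⟩ := Omega.exists_least (P := fun e => ¬ E e (φ y).1)
        (.not (hEdfn (.var _) (.const _))) hex
      have hae : ∀ α, a α < e := fun α => not_le.1 fun hle => he (hE₁ _ _ _ hle (hlow α))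
      obtain ⟨k, hk⟩ := Omega.exists_covBy_of_lt (hae α₀)
      refine ⟨k, fun α => ?_, ?_⟩
      · obtain ⟨β, hβ⟩ := hκ.exists_gt α
        exact (ha hβ).trans_le (hk.le_of_lt (hae β))
      · by_contra h
        exact absurd (hmin k h) (not_le.2 hk.lt)
    · push Not at hex
      exact ⟨b β₀, fun α => hab α β₀, hex _⟩
  · -- otherwise the least `y` with `E e y` would be the least upper bound of `a'`
    intro e he
    by_contra! hall
    have hleast : ∃ y : L, E e.1 (φ y).1 ∧ ∀ y', E e.1 (φ y').1 → y ≤ y' := by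
      have hex : ∃ y : Omega M, E e.1 y.1 := ⟨φ (b' β₀'), hall _ fun α => hab' α β₀'⟩
      have hP : Dfn fun v : Fin 1 → M => E e.1 (v 0) := hEdfn (.const _) (.var _)
      cases d
      · obtain ⟨y, hy, hmax⟩ := Omega.exists_greatest hP hex n (by
          intro y hy
          obtain ⟨z, hz, hzy⟩ := hy e.1 (Or.inr rfl)
          have hzn := t.pairMem_mem hz
          have : y ≤ Omega.ofMem hzn := Omega.le_iff.2 (hzy.imp_right Eq.symm)
          exact this.trans (le_of_lt hzn))
        obtain ⟨y, rfl⟩ := hsurj y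
        exact ⟨y, hy, fun y' hy' => (hφ _ _).2
          ((Omega.le_iff.1 (hmax _ hy')).imp_right Eq.symm)⟩
      · obtain ⟨y, hy, hmin⟩ := Omega.exists_least hP hex
        obtain ⟨y, rfl⟩ := hsurj y
        exact ⟨y, hy, fun y' hy' => (hφ _ _).2 (Omega.le_iff.1 (hmin _ hy'))⟩
    obtain ⟨y, hy, hmin⟩ := hleast
    have hay : ∀ α, a' α ≤ y := by
      intro α
      obtain ⟨z, hz, hzy⟩ := hy (a α).1 (Or.inl (he α))
      rw [t.pairMem_unique hz (ht α)] at hzy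
      exact (hφ _ _).2 hzy
    have hay' : ∀ α, a' α < y := fun α => by
      obtain ⟨β, hβ⟩ := hκ.exists_gt α
      exact (ha' hβ).trans_le (hay β)
    obtain ⟨k, hk⟩ := hpred _ _ (hay' α₀)
    refine absurd (hmin k (hall k fun α => ?_)) (not_le.2 hk.lt)
    obtain ⟨β, hβ⟩ := hκ.exists_gt α
    exact (ha' hβ).trans_le (hk.le_of_lt (hay' β))

end Uniqueness

/-! ### The invariants -/

section Invariants

variable {M : Type u} [setLang.Structure M]

theorem exists_bound_of_lt_tInv {κ : Cardinal.{u}} (h : (κ : WithTop Cardinal.{u}) < tInv M)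
    (n : Omega M) (μ : Cardinal.{u}) (hμ : μ.IsRegular) (hle : μ ≤ κ) (s : Iio μ.ord → FinSeq n)
    (hs : StrictMono s) : ∃ t, ∀ α, s α ≤ t := by
  by_contra hc
  have h1 : tInv M ≤ (μ : WithTop Cardinal.{u}) :=
    (iInf_le _ n).trans (iInf₂_le μ ⟨hμ, s, hs, hc⟩)
  exact absurd (h.trans_le h1) (not_lt.2 (WithTop.coe_le_coe.2 hle))

theorem le_add_of_le_cutNumber {L : Type u} [LT L] {κ : Cardinal.{u}}
    (h : (κ : WithTop Cardinal.{u}) ≤ cutNumber L) (μ ν : Cardinal.{u})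
    (hc : (μ, ν) ∈ cutSpectrum L) : κ ≤ μ + ν :=
  WithTop.coe_le_coe.1 (h.trans (iInf₂_le (μ, ν) hc))

variable [hM : Fact (IsZFCMinus M)]

theorem IsOmegaNonstandard.exists_Ioo_infinite (h : IsOmegaNonstandard M) :
    ∃ c d : Omega M, (Ioo c d).Infinite := by
  obtain ⟨n, hn⟩ := h
  obtain ⟨z, -, hz⟩ := Omega.exists_least (M := M) (P := fun x => x = x)
    (.eq (.var _) (.var _)) ⟨n, rfl⟩
  refine ⟨z, n, fun hfin => hn ((hfin.union (finite_singleton z)).subset fun m hm => ?_)⟩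
  rcases eq_or_lt_of_le (hz m rfl) with h | h
  · exact Or.inr h.symm
  · exact Or.inl ⟨h, hm⟩

end Invariants

end SetModel

end

theorem mainTheorem5 (M : Type u) [setLang.Structure M] (hM : SetModel.IsZFCMinus M)
    (hω : SetModel.IsOmegaNonstandard M) (κ : Cardinal.{u}) (hκ : κ.IsRegular)
    (hlt : (κ : WithTop Cardinal.{u}) < min (Order.succ (SetModel.pInv M)) (SetModel.tInv M)) :
    ∃ μ : Cardinal.{u}, μ.IsRegular ∧
      ((κ, μ) ∈ SetModel.spectrum M ∧
        ∀ ν : Cardinal.{u}, ν.IsRegular → (κ, ν) ∈ SetModel.spectrum M → ν = μ) ∧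
      ((μ, κ) ∈ SetModel.spectrum M ∧
        ∀ ν : Cardinal.{u}, ν.IsRegular → (ν, κ) ∈ SetModel.spectrum M → ν = μ) := by
  have : Fact (SetModel.IsZFCMinus M) := ⟨hM⟩
  have hT := SetModel.exists_bound_of_lt_tInv (hlt.trans_le (min_le_right _ _))
  have hp := SetModel.le_add_of_le_cutNumber
    (Order.le_of_lt_succ (hlt.trans_le (min_le_left _ _)))
  have hpred : ∀ x y : SetModel.Omega M, x < y → ∃ z, z ⋖ y := fun _ _ h =>
    SetModel.Omega.exists_covBy_of_lt h
  have hsucc : ∀ x y : SetModel.Omega M, x < y → ∃ z, x ⋖ z := fun x _ _ => x.exists_covBy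
  have hpred' : ∀ x y : (SetModel.Omega M)ᵒᵈ, x < y → ∃ z, z ⋖ y := fun x y h => by
    obtain ⟨z, hz⟩ := hsucc _ _ h
    exact ⟨OrderDual.toDual z, hz.toDual⟩
  have hsucc' : ∀ x y : (SetModel.Omega M)ᵒᵈ, x < y → ∃ z, x ⋖ z := fun x y h => by
    obtain ⟨z, hz⟩ := hpred _ _ h
    exact ⟨OrderDual.toDual z, hz.toDual⟩
  obtain ⟨c, d, hcd⟩ := hω.exists_Ioo_infinite
  obtain ⟨μ, hμ⟩ := exists_cut_of_le_cutNumber hpred hsucc c d hcd hκ hp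
  obtain ⟨θ, hθ⟩ := exists_cut_of_le_cutNumber hpred' hsucc' (OrderDual.toDual d)
    (OrderDual.toDual c) (by rw [Set.Ioo_toDual]; exact hcd) hκ fun μ ν h => by
      rw [add_comm]
      exact hp _ _ (mem_cutSpectrum_orderDual.1 h)
  -- the comparison of two cuts of the same, respectively of opposite, orientation
  have hsame : ∀ {μ ν}, (κ, μ) ∈ cutSpectrum (SetModel.Omega M) →
      (κ, ν) ∈ cutSpectrum (SetModel.Omega M) → μ = ν := fun h h' =>
    SetModel.right_cofinality_unique (d := true) (φ := id) (fun _ _ => SetModel.Omega.le_iff)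
      Function.surjective_id hpred hT h h'
  have hopp : ∀ {μ ν}, (κ, μ) ∈ cutSpectrum (SetModel.Omega M) →
      (κ, ν) ∈ cutSpectrum (SetModel.Omega M)ᵒᵈ → μ = ν := fun h h' =>
    SetModel.right_cofinality_unique (L := (SetModel.Omega M)ᵒᵈ) (d := false)
      (φ := OrderDual.ofDual)
      (fun _ _ => SetModel.Omega.le_iff.trans (or_congr_right eq_comm))
      OrderDual.ofDual.surjective hpred' hT h h'
  obtain rfl := hopp hμ hθ
  exact ⟨μ, hμ.2.1, ⟨hμ, fun ν _ h => hsame h hμ⟩, mem_cutSpectrum_orderDual.1 hθ,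
    fun ν _ h => (hopp hμ (mem_cutSpectrum_orderDual.2 h)).symm⟩
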